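/- Let $\mathfrak{E}$ be a finite-dimensional Euclidean space, $\Phi\subset\mathfrak{E}$ a finite (reduced, crystallographic) root system spanning $\mathfrak{E}$, with simple roots $\{\alpha_i\}_{i\in I}$, coroots $\alpha^\vee$, Weyl group $W$, and fundamental weights $\{\omega_i\}_{i\in I}$ (dual to the simple coroots). Let $\Lambda$ (respectively $\Lambda^+$) be the set of integral (respectively nonnegative integral) linear combinations of the $\omega_i$, and for $\mu,\nu\in\Lambda$ write $\mu\le\nu$ if $\nu-\mu=\sum_{i\in I}k_i\alpha_i$ with all $k_i\in\mathbb{Z}_{\ge0}$. For $\lambda\in\Lambda^+$ the weight diagram is $\Pi(\lambda)=\{w(\nu) : w\in W,\ \nu\in\Lambda^+,\ \nu\le\lambda\}$, ordered as a subset of $\Lambda$ and regarded as an edge-colored directed graph: there is an edge $\mu\xrightarrow{i}\nu$ for each covering relation with $\mu+\alpha_i=\nu$. Let $R$ be a finite partially ordered set, identified with its Hasse diagram (an edge $s\to t$ for each covering relation $s<t$), whose edges are colored by $I$, and which is ranked: for some $l\ge 0$ there is a surjection $\rho:R\to\{0,1,\ldots,l\}$ with $\rho(s)+1=\rho(t)$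 whenever $s\to t$ (so $R$ is nonempty). For $x\in R$ and $i\in I$, the $i$-component of $x$ is the connected component of $x$ in the graph formed by the edges of color $i$; it is itself ranked. Let $\rho_i(x)$ be the rank of $x$ in it, $l_i(x)$ its length, $\delta_i(x)=l_i(x)-\rho_i(x)$, $m_i(x)=\rho_i(x)-\delta_i(x)$, and $wt(x)=\sum_{i\in I}m_i(x)\,\omega_i\in\Lambda$. Call $x$ prominent if $\delta_i(x)=0$ for all $i\in I$. Assume that $R$ is $M_\Phi$-structured: $wt(s)+\alpha_i=wt(t)$ whenever $s\xrightarrow{i}t$ in $R$. Let $\Pi(R)$ be the edge-colored directed graph with vertex set $\{wt(x) : x\in R\}$ and with an edge $\mu\xrightarrow{i}\nu$ whenever there is an edge $x\xrightarrow{i}y$ in $R$ with $wt(x)=\mu$ and $wt(y)=\nu$. A nonempty set $\mathscr{D}$ of prominent elements of $R$ is indomitable if for each prominent $x\in R$ there is some $d\in\mathscr{D}$ with $wt(x)\le wt(d)$; it is minimally indomitable if moreover no proper subset of $\mathscr{D}$ is indomitable. The union of edge-colored directed graphs is formed by taking the union of the vertex sets and, for each color, the union of the sets of edges of that color. **Theorem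 3.8.** Let $\mathscr{N}$ be any set of elements of $R$ such that $wt(n)\in\Lambda^+$ for each $n\in\mathscr{N}$. The following are equivalent: 1. $\Pi(R)=\bigcup_{n\in\mathscr{N}}\Pi(wt(n))$ as edge-colored directed graphs; 2. $\Pi(R)=\bigcup_{n\in\mathscr{N}}\Pi(wt(n))$ as sets (of vertices); 3. $\mathscr{D}\subseteq\mathscr{N}$ for some minimally indomitable set $\mathscr{D}$ of prominent elements of $R$. -/

import Mathlib

namespace WeightDiagrams

/-! ### Ranked posets with colored Hasse diagram edges -/

/-- `ρ` is a rank function of length `l` on the directed graph with edge relation `E`: it maps onto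
`{0, 1, …, l}` and goes up by one along each edge. -/
def IsRankFunction {V : Type*} (E : V → V → Prop) (ρ : V → ℕ) (l : ℕ) : Prop :=
  Set.range ρ = Set.Iic l ∧ ∀ s t, E s t → ρ s + 1 = ρ t

/-- The structure of a ranked poset whose Hasse diagram edges (the covering relations) are colored
by the set `I`. -/
structure ColoredRankedPoset (R : Type*) [PartialOrder R] (I : Type*) where
  /-- the color of each edge of the Hasse diagram -/
  color : {e : R × R // e.1 ⋖ e.2} → I
  ranked : ∃ (ρ : R → ℕ) (l : ℕ), IsRankFunction (fun s t : R => s ⋖ t) ρ l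

namespace ColoredRankedPoset

variable {R : Type*} [PartialOrder R] {I : Type*} (X : ColoredRankedPoset R I)

/-- `X.Edge i s t`: there is an edge from `s` up to `t` of color `i`. -/
def Edge (i : I) (s t : R) : Prop :=
  ∃ h : s ⋖ t, X.color ⟨(s, t), h⟩ = i

/-- The `i`-component of `x`: all elements joined to `x` by a path (edges may be traversed in both
directions) all of whose edges have color `i`. -/
def comp (i : I) (x : R) : Set R :=
  {y | Relation.EqvGen (X.Edge i) x y}

theorem mem_comp_self (i : I) (x : R) : x ∈ X.comp i x := Relation.EqvGen.refl x

/-- Each `i`-component of a ranked poset is ranked. -/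
theorem exists_compRank (i : I) (x : R) :
    ∃ p : (X.comp i x → ℕ) × ℕ,
      IsRankFunction (fun s t : X.comp i x => X.Edge i s t) p.1 p.2 := by
  obtain ⟨ρ, L, hρ, hE⟩ := X.ranked
  have key : ∀ a b : R, Relation.EqvGen (X.Edge i) a b →
      ∀ k, (ρ a ≤ k ∧ k ≤ ρ b ∨ ρ b ≤ k ∧ k ≤ ρ a) →
        ∃ c, Relation.EqvGen (X.Edge i) a c ∧ ρ c = k := by
    intro a b h
    induction h with
    | rel a b h =>
      intro k hk
      have h1 := hE a b h.1
      by_cases hka : ρ a = k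
      · exact ⟨a, .refl a, hka⟩
      · exact ⟨b, .rel _ _ h, by omega⟩
    | refl a => intro k hk; exact ⟨a, .refl a, by omega⟩
    | symm a b h ih =>
      intro k hk
      obtain ⟨c, hc, hck⟩ := ih k hk.symm
      exact ⟨c, .trans _ _ _ (.symm _ _ h) hc, hck⟩
    | trans a b c hab hbc ih1 ih2 =>
      intro k hk
      by_cases h1 : ρ a ≤ k ∧ k ≤ ρ b ∨ ρ b ≤ k ∧ k ≤ ρ a
      · exact ih1 k h1
      · obtain ⟨d, hd, hdk⟩ := ih2 k (by omega)
        exact ⟨d, .trans _ _ _ hab hd, hdk⟩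
  have hne : (ρ '' X.comp i x).Nonempty := ⟨ρ x, x, X.mem_comp_self i x, rfl⟩
  have hbdd : BddAbove (ρ '' X.comp i x) := by
    refine ⟨L, ?_⟩
    rintro _ ⟨y, -, rfl⟩
    have : ρ y ∈ Set.range ρ := ⟨y, rfl⟩
    rwa [hρ] at this
  obtain ⟨y0, hy0, hmin⟩ := Nat.sInf_mem hne
  obtain ⟨y1, hy1, hmax⟩ := Nat.sSup_mem hne hbdd
  have hlo : ∀ y ∈ X.comp i x, ρ y0 ≤ ρ y := fun y hy => hmin ▸ Nat.sInf_le ⟨y, hy, rfl⟩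
  have hhi : ∀ y ∈ X.comp i x, ρ y ≤ ρ y1 := fun y hy => hmax ▸ le_csSup hbdd ⟨y, hy, rfl⟩
  refine ⟨(fun y => ρ y - ρ y0, ρ y1 - ρ y0), ?_, ?_⟩
  · ext k
    constructor
    · rintro ⟨y, rfl⟩
      have := hhi y y.2
      simp only [Set.mem_Iic]
      omega
    · intro hk
      have h01 := hlo y1 hy1
      simp only [Set.mem_Iic] at hk
      obtain ⟨c, hc, hck⟩ := key y0 y1 (.trans _ _ _ (.symm _ _ hy0) hy1) (k + ρ y0)
        (Or.inl ⟨by omega, by omega⟩)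
      exact ⟨⟨c, .trans _ _ _ hy0 hc⟩, by simp only; omega⟩
  · intro s t hst
    have h1 := hE s t hst.1
    have h2 := hlo s s.2
    simp only
    omega

/-- The rank function of an `i`-component is unique, and so is its length. -/
theorem compRank_unique (i : I) (x : R) (ρ ρ' : X.comp i x → ℕ) (l l' : ℕ)
    (h : IsRankFunction (fun s t : X.comp i x => X.Edge i s t) ρ l)
    (h' : IsRankFunction (fun s t : X.comp i x => X.Edge i s t) ρ' l') :
    ρ = ρ' ∧ l = l' := by
  have key : ∀ a b : R, Relation.EqvGen (X.Edge i) a b →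
      ∀ (ha : a ∈ X.comp i x) (hb : b ∈ X.comp i x),
        ρ ⟨a, ha⟩ + ρ' ⟨b, hb⟩ = ρ ⟨b, hb⟩ + ρ' ⟨a, ha⟩ := by
    intro a b hab
    induction hab with
    | rel a b hab =>
      intro ha hb
      have h1 := h.2 ⟨a, ha⟩ ⟨b, hb⟩ hab
      have h2 := h'.2 ⟨a, ha⟩ ⟨b, hb⟩ hab
      omega
    | refl a => intro ha hb; rfl
    | symm a b _ ih => intro ha hb; have := ih hb ha; omega
    | trans a b c hab _ ih1 ih2 =>
      intro ha hc
      have hb : b ∈ X.comp i x := .trans _ _ _ ha hab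
      have := ih1 ha hb
      have := ih2 hb hc
      omega
  have hc : ∀ a b : X.comp i x, ρ a + ρ' b = ρ b + ρ' a := fun a b =>
    key a b (.trans _ _ _ (.symm _ _ a.2) b.2) a.2 b.2
  obtain ⟨a, ha⟩ : 0 ∈ Set.range ρ := by rw [h.1]; exact Nat.zero_le _
  obtain ⟨a', ha'⟩ : 0 ∈ Set.range ρ' := by rw [h'.1]; exact Nat.zero_le _
  have hρ : ρ = ρ' := by
    funext y
    have h1 := hc a a'
    have h2 := hc a y
    omega
  refine ⟨hρ, ?_⟩
  have : Set.Iic l = Set.Iic l' := by rw [← h.1, ← h'.1, hρ]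
  exact Set.Iic_injective this

/-- `ρ_i(x)`: the rank of `x` within its `i`-component. -/
noncomputable def rho (i : I) (x : R) : ℕ :=
  (X.exists_compRank i x).choose.1 ⟨x, X.mem_comp_self i x⟩

/-- `l_i(x)`: the length of the `i`-component of `x`. -/
noncomputable def len (i : I) (x : R) : ℕ :=
  (X.exists_compRank i x).choose.2

/-- `δ_i(x) = l_i(x) - ρ_i(x)`. -/
noncomputable def delta (i : I) (x : R) : ℤ :=
  (X.len i x : ℤ) - X.rho i x

/-- `m_i(x) = ρ_i(x) - δ_i(x) = 2 ρ_i(x) - l_i(x)`. -/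
noncomputable def m (i : I) (x : R) : ℤ :=
  (X.rho i x : ℤ) - X.delta i x

/-- `x` is prominent if `δ_i(x) = 0` for every color `i`. -/
def IsProminent (x : R) : Prop :=
  ∀ i : I, X.delta i x = 0

end ColoredRankedPoset

/-! ### Edge-colored directed graphs -/

/-- An edge-colored directed graph with vertices in `V` and colors in `I`, given by its vertex set
and, for each color `i`, its set of directed edges of color `i`. Two such graphs are equal when they
have the same vertices and, for every color, the same directed edges. -/
@[ext]
structure ColoredDigraph (V I : Type*) where
  verts : Set V
  Adj : I → V → V → Prop
  mem_left : ∀ i μ ν, Adj i μ ν → μ ∈ verts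
  mem_right : ∀ i μ ν, Adj i μ ν → ν ∈ verts

/-- The union of a family of edge-colored directed graphs: union of the vertex sets and, color by
color, union of the edge sets. -/
def ColoredDigraph.iUnion {V I K : Type*} (G : K → ColoredDigraph V I) : ColoredDigraph V I where
  verts := ⋃ k, (G k).verts
  Adj i μ ν := ∃ k, (G k).Adj i μ ν
  mem_left := by
    rintro i μ ν ⟨k, h⟩
    exact Set.mem_iUnion.2 ⟨k, (G k).mem_left i μ ν h⟩
  mem_right := by
    rintro i μ ν ⟨k, h⟩
    exact Set.mem_iUnion.2 ⟨k, (G k).mem_right i μ ν h⟩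

/-! ### Weights -/

section Weights

variable {ι E F : Type*} [AddCommGroup E] [Module ℝ E] [AddCommGroup F] [Module ℝ F]
  {P : RootPairing ι ℝ E F} (b : P.Base)

/-- The fundamental weights, dual to the simple coroots. -/
noncomputable def fundWeight [P.IsRootSystem] (i : b.support) : E :=
  P.toLinearMap.toPerfPair.symm (b.toCoweightBasis.coord i)

theorem fundWeight_coroot [P.IsRootSystem] [DecidableEq ι] (i j : b.support) :
    P.toLinearMap (fundWeight b i) (P.coroot j) = if i = j then 1 else 0 := by
  have h : P.toLinearMap (fundWeight b i) = b.toCoweightBasis.coord i :=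
    P.toLinearMap.toPerfPair.apply_symm_apply _
  rw [h, ← b.toCoweightBasis_apply j, Module.Basis.coord_apply, Module.Basis.repr_self,
    Finsupp.single_apply]
  simp only [eq_comm]

/-- The lattice of weights `Λ`: the `ℤ`-span of the fundamental weights. -/
def weightLattice [P.IsRootSystem] : Set E :=
  {μ | ∃ a : b.support → ℤ, μ = ∑ i, a i • fundWeight b i}

/-- The dominant weights `Λ⁺`. -/
def dominantWeights [P.IsRootSystem] : Set E :=
  {μ | ∃ a : b.support → ℕ, μ = ∑ i, a i • fundWeight b i}

/-- The partial order on weights: `μ ≤ ν` if and only if `ν - μ` is a nonnegative integral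
combination of simple roots. -/
def WeightLE (μ ν : E) : Prop :=
  ∃ k : b.support → ℕ, ν - μ = ∑ i, k i • P.root i

/-- The underlying set of the weight diagram `Π(lam)`. -/
def weightDiagramSet [P.IsRootSystem] (lam : E) : Set E :=
  {μ | μ ∈ weightLattice b ∧
    ∃ w ∈ P.weylGroup, ∃ ν ∈ dominantWeights b, WeightLE b ν lam ∧ μ = w • ν}

/-- The weight diagram `Π(lam)`. Its edges are those of the Hasse diagram of `Π(lam)` in the order
induced from `Λ`: an edge of color `i` from `μ` to `ν` is a covering relation with
`μ + α_i = ν`. -/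
def weightDiagram [P.IsRootSystem] (lam : E) : ColoredDigraph E b.support where
  verts := weightDiagramSet b lam
  Adj i μ ν := μ ∈ weightDiagramSet b lam ∧ ν ∈ weightDiagramSet b lam ∧
    (μ ≠ ν ∧ WeightLE b μ ν ∧
      ∀ ξ ∈ weightDiagramSet b lam, WeightLE b μ ξ → WeightLE b ξ ν → μ = ξ ∨ ξ = ν) ∧
    μ + P.root i = ν
  mem_left _ _ _ h := h.1
  mem_right _ _ _ h := h.2.1

variable {R : Type*} [PartialOrder R] (X : ColoredRankedPoset R b.support)

/-- The weight `wt(x) = ∑ m_i(x) ω_i` of an element of `R`. -/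
noncomputable def wt [P.IsRootSystem] (x : R) : E :=
  ∑ i, X.m i x • fundWeight b i

/-- `R` is `M_Φ`-structured: `wt(s) + α_i = wt(t)` for each edge `s → t` of color `i`. -/
def IsStructured [P.IsRootSystem] : Prop :=
  ∀ (i : b.support) (s t : R), X.Edge i s t → wt b X s + P.root i = wt b X t

/-- The generalized weight diagram `Π(R)`. -/
def genWeightDiagram [P.IsRootSystem] : ColoredDigraph E b.support where
  verts := Set.range (wt b X)
  Adj i μ ν := ∃ x y : R, X.Edge i x y ∧ wt b X x = μ ∧ wt b X y = ν
  mem_left := by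
    rintro i μ ν ⟨x, y, -, h, -⟩
    exact ⟨x, h⟩
  mem_right := by
    rintro i μ ν ⟨x, y, -, -, h⟩
    exact ⟨y, h⟩

/-- `D` is a nonempty set of prominent elements such that the weight of each prominent element is
below the weight of some element of `D`. -/
def IsIndomitable [P.IsRootSystem] (D : Set R) : Prop :=
  D.Nonempty ∧ (∀ d ∈ D, X.IsProminent d) ∧
    ∀ x : R, X.IsProminent x → ∃ d ∈ D, WeightLE b (wt b X x) (wt b X d)

/-- `D` is indomitable, and no proper subset of `D` is. -/
def IsMinimallyIndomitable [P.IsRootSystem] (D : Set R) : Prop :=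
  IsIndomitable b X D ∧ ∀ D' : Set R, D' ⊂ D → ¬ IsIndomitable b X D'

end Weights

end WeightDiagrams

/-! The proof rests on string-closed sets of weights: along with μ, such a set contains the part of
the α_i-string from μ to its reflection, for every i. It is therefore stable under the Weyl group.
It also contains every dominant ν below a member λ: a simple root that occurs in λ − ν and pairs
positively with it can be subtracted from λ without leaving the set, until ν is reached
(`IsStringClosed.mem_of_dominant`). Hence it contains Π(λ). The weights of R are string-closed
because an i-component attains all its ranks, so Π(R) contains the union for every choice of N.

For the reverse inclusion, a weight of R has a dominant conjugate, again a weight of R, which lies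
below a maximal weight. An element of maximal weight is prominent, since otherwise an edge would
lead to a higher weight; so it lies below a member of any indomitable set. Conversely, a dominant
weight in Π(λ) is at most λ, so equality of vertex sets makes every maximal weight the weight of
some n in N. One such n for each maximal weight gives a minimally indomitable set.

Edges carry no further information: on both sides μ and μ + α_i are joined as soon as both are
vertices (`genWeightDiagram_adj_iff`, `exists_common_weightDiagramSet`). For the union this uses
that weight diagrams are string-closed as well. -/

namespace WeightDiagrams

section RootSystem

variable {ι E F : Type*} [AddCommGroup E] [Module ℝ E] [AddCommGroup F] [Module ℝ F]
  {P : RootPairing ι ℝ E F} (b : P.Base)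

/-! ### The order on weights -/

theorem WeightLE.refl (μ : E) : WeightLE b μ μ := ⟨0, by simp⟩

variable {b}

theorem WeightLE.trans {μ ν ξ : E} (h₁ : WeightLE b μ ν) (h₂ : WeightLE b ν ξ) :
    WeightLE b μ ξ := by
  obtain ⟨k, hk⟩ := h₁
  obtain ⟨k', hk'⟩ := h₂
  refine ⟨k + k', ?_⟩
  simp only [Pi.add_apply, add_smul, Finset.sum_add_distrib, ← hk, ← hk']
  abel

variable (b)

theorem weightLE_add_root (μ : E) (i : b.support) : WeightLE b μ (μ + P.root i) := by
  classical
  refine ⟨Pi.single i 1, ?_⟩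
  rw [Finset.sum_eq_single i (by intro j _ hj; simp [hj]) (by simp)]
  simp

/-- The linear functional taking the value `1` on each simple root. -/
noncomputable def heightFun [P.IsRootSystem] : E →ₗ[ℝ] ℝ :=
  b.toWeightBasis.constr ℝ (fun _ => (1 : ℝ))

theorem heightFun_root [P.IsRootSystem] (i : b.support) : heightFun b (P.root i) = 1 := by
  rw [← b.toWeightBasis_apply, heightFun, Module.Basis.constr_basis]

variable {b}

/-- The height difference is the sum of the nonnegative coefficients, so it vanishes only if all of
them do. Thus maximizing height yields maximal weights. -/
theorem WeightLE.eq_of_heightFun_le [P.IsRootSystem] {μ ν : E} (h : WeightLE b μ ν)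
    (h' : heightFun b ν ≤ heightFun b μ) : μ = ν := by
  obtain ⟨k, hk⟩ := h
  have h1 : heightFun b (ν - μ) = ∑ i, (k i : ℝ) := by
    rw [hk, map_sum]
    exact Finset.sum_congr rfl fun i _ => by rw [map_nsmul, heightFun_root]; simp
  rw [map_sub] at h1
  have h2 : ∑ i, (k i : ℝ) = 0 :=
    le_antisymm (by linarith) (Finset.sum_nonneg fun i _ => Nat.cast_nonneg _)
  rw [Finset.sum_eq_zero_iff_of_nonneg fun i _ => Nat.cast_nonneg _] at h2
  have h3 : ν - μ = 0 := by
    rw [hk]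
    exact Finset.sum_eq_zero fun i hi => by
      rw [Nat.cast_eq_zero.1 (h2 i hi), zero_smul]
  exact (sub_eq_zero.1 h3).symm

theorem WeightLE.heightFun_le [P.IsRootSystem] {μ ν : E} (h : WeightLE b μ ν) :
    heightFun b μ ≤ heightFun b ν := by
  by_contra! h'
  rw [h.eq_of_heightFun_le h'.le] at h'
  exact lt_irrefl _ h'

theorem WeightLE.antisymm [P.IsRootSystem] {μ ν : E} (h : WeightLE b μ ν)
    (h' : WeightLE b ν μ) : μ = ν :=
  h.eq_of_heightFun_le h'.heightFun_le

theorem not_weightLE_of_add_root [P.IsRootSystem] (μ : E) (i : b.support) :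
    ¬ WeightLE b (μ + P.root i) μ := by
  intro h
  have := h.heightFun_le
  rw [map_add, heightFun_root] at this
  linarith

/-- Nothing lies strictly between `μ` and `μ + α_i`. -/
theorem WeightLE.eq_or_eq_of_between {μ ξ : E} {i : b.support} (h₁ : WeightLE b μ ξ)
    (h₂ : WeightLE b ξ (μ + P.root i)) : μ = ξ ∨ ξ = μ + P.root i := by
  classical
  obtain ⟨k, hk⟩ := h₁
  obtain ⟨k', hk'⟩ := h₂
  have h : ∑ j, ((k + k') j : ℕ) • P.root j =
      ∑ j, ((Pi.single i 1 : b.support → ℕ) j) • P.root j := by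
    rw [Finset.sum_eq_single (f := fun j => ((Pi.single i 1 : b.support → ℕ) j) • P.root j) i
      (by intro j _ hj; simp [hj]) (by simp)]
    simp only [Pi.add_apply, add_smul, Finset.sum_add_distrib, ← hk, ← hk']
    simp
  have h' : ∀ j, (k + k') j = (Pi.single i 1 : b.support → ℕ) j := by
    have hli := b.linearIndepOn_root.restrict_scalars' ℕ
    exact Fintype.linearIndependent_iffₛ.mp hli _ _ h
  have hz : k i = 0 ∨ k' i = 0 := by
    have := h' i
    simp at this
    omega
  have hne : ∀ j, j ≠ i → k j = 0 ∧ k' j = 0 := by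
    intro j hj
    have := h' j
    simp [hj] at this
    exact this
  rcases hz with hz | hz
  · left
    have : ξ - μ = 0 := by
      rw [hk]
      refine Finset.sum_eq_zero fun j _ => ?_
      by_cases hj : j = i
      · rw [hj, hz, zero_smul]
      · rw [(hne j hj).1, zero_smul]
    exact (sub_eq_zero.1 this).symm
  · right
    have : μ + P.root i - ξ = 0 := by
      rw [hk']
      refine Finset.sum_eq_zero fun j _ => ?_
      by_cases hj : j = i
      · rw [hj, hz, zero_smul]
      · rw [(hne j hj).2, zero_smul]
    exact (sub_eq_zero.1 this).symm

theorem weightLE_sub_nsmul_root {k : ι} (hk : b.IsPos k) (μ : E) (n : ℕ) :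
    WeightLE b (μ - n • P.root k) μ := by
  suffices h : ∃ f : b.support → ℕ, P.root k = ∑ i, f i • P.root i by
    obtain ⟨f, hf⟩ := h
    refine ⟨fun i => n * f i, ?_⟩
    simp only [mul_smul, ← Finset.smul_sum, ← hf, sub_sub_cancel]
  obtain ⟨f, -, hf | hf⟩ := b.exists_root_eq_sum_nat_or_neg k
  · exact ⟨fun i => f i, by rw [hf]; exact (Finset.sum_coe_sort _ (fun i => f i • P.root i)).symm⟩
  -- A nonpositive combination of simple roots has height at most 0, against positivity of `k`.
  · exfalso
    have h1 : P.root k = ∑ j ∈ b.support, (-(f j : ℤ)) • P.root j := by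
      rw [hf, ← Finset.sum_neg_distrib]
      simp
    have h2 := RootPairing.Base.height_eq_sum h1
    rw [RootPairing.Base.isPos_iff, h2] at hk
    have : ∑ j ∈ b.support, (-(f j : ℤ)) ≤ 0 :=
      Finset.sum_nonpos fun j _ => by simp
    omega

theorem weightLE_of_sub_eq_zsmul_root {k : ι} {μ ν : E} {n : ℤ} (h : ν - μ = n • P.root k)
    (hn : b.IsPos k ∧ 0 ≤ n ∨ ¬ b.IsPos k ∧ n ≤ 0) : WeightLE b μ ν := by
  rcases hn with ⟨hk, hn⟩ | ⟨hk, hn⟩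
  · lift n to ℕ using hn
    have : μ = ν - n • P.root k := by
      rw [← natCast_zsmul, ← h, sub_sub_cancel]
    rw [this]
    exact weightLE_sub_nsmul_root hk ν n
  · let := P.indexNeg
    have hk' : b.IsPos (-k) := (RootPairing.Base.IsPos.neg_iff_not b k).2 hk
    obtain ⟨m, rfl⟩ : ∃ m : ℕ, n = -(m : ℤ) := ⟨(-n).toNat, by omega⟩
    have hneg : P.root (-k) = -P.root k := by simp
    have : μ = ν - m • P.root (-k) := by
      rw [hneg, ← natCast_zsmul, smul_neg, ← neg_smul, ← h, sub_sub_cancel]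
    rw [this]
    exact weightLE_sub_nsmul_root hk' ν m

/-! ### Dominant and integral weights in terms of the simple coroots -/

theorem eq_sum_coroot_smul_fundWeight [P.IsRootSystem] (μ : E) :
    μ = ∑ i : b.support, P.coroot' i μ • fundWeight b i := by
  classical
  apply P.toLinearMap.toPerfPair.injective
  apply b.toCoweightBasis.ext
  intro j
  rw [b.toCoweightBasis_apply, map_sum, LinearMap.sum_apply, Finset.sum_eq_single j]
  · rw [map_smul, LinearMap.smul_apply]
    have := fundWeight_coroot b j j
    simp only [if_true] at this
    change _ = _ • P.toLinearMap (fundWeight b j) (P.coroot j)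
    rw [this]
    simp
  · intro i _ hij
    rw [map_smul, LinearMap.smul_apply]
    change _ • P.toLinearMap (fundWeight b i) (P.coroot j) = 0
    rw [fundWeight_coroot, if_neg hij, smul_zero]
  · simp

theorem coroot_sum_zsmul_fundWeight [P.IsRootSystem] (a : b.support → ℤ) (j : b.support) :
    P.coroot' j (∑ i, a i • fundWeight b i) = a j := by
  classical
  rw [map_sum, Finset.sum_eq_single j]
  · rw [map_zsmul]
    change _ • P.toLinearMap (fundWeight b j) (P.coroot j) = _
    rw [fundWeight_coroot]
    simp
  · intro i _ hij
    rw [map_zsmul]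
    change _ • P.toLinearMap (fundWeight b i) (P.coroot j) = _
    rw [fundWeight_coroot, if_neg hij, smul_zero]
  · simp

theorem mem_weightLattice_iff [P.IsRootSystem] {μ : E} :
    μ ∈ weightLattice b ↔ ∀ i : b.support, ∃ n : ℤ, P.coroot' i μ = n := by
  constructor
  · rintro ⟨a, rfl⟩ i
    exact ⟨a i, coroot_sum_zsmul_fundWeight a i⟩
  · intro h
    choose a ha using h
    refine ⟨a, ?_⟩
    conv_lhs => rw [eq_sum_coroot_smul_fundWeight (b := b) μ]
    exact Finset.sum_congr rfl fun i _ => by rw [ha, Int.cast_smul_eq_zsmul]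

theorem mem_dominantWeights_iff [P.IsRootSystem] {μ : E} :
    μ ∈ dominantWeights b ↔ ∀ i : b.support, ∃ n : ℕ, P.coroot' i μ = n := by
  constructor
  · rintro ⟨a, rfl⟩ i
    refine ⟨a i, ?_⟩
    have := coroot_sum_zsmul_fundWeight (b := b) (fun i => (a i : ℤ)) i
    simpa using this
  · intro h
    choose a ha using h
    refine ⟨a, ?_⟩
    conv_lhs => rw [eq_sum_coroot_smul_fundWeight (b := b) μ]
    exact Finset.sum_congr rfl fun i _ => by rw [ha, Nat.cast_smul_eq_nsmul]

theorem dominantWeights_subset_weightLattice [P.IsRootSystem] :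
    dominantWeights b ⊆ weightLattice b := by
  intro μ hμ
  rw [mem_dominantWeights_iff] at hμ
  rw [mem_weightLattice_iff]
  intro i
  obtain ⟨n, hn⟩ := hμ i
  exact ⟨n, by simp [hn]⟩

theorem coroot_root_self (i : ι) : P.coroot' i (P.root i) = 2 := P.root_coroot_two i

theorem exists_coroot_root_eq_int [P.IsCrystallographic] (i j : ι) :
    ∃ n : ℤ, P.coroot' i (P.root j) = n :=
  ⟨P.pairingIn ℤ j i, by
    rw [RootPairing.root_coroot'_eq_pairing, ← P.algebraMap_pairingIn ℤ]; simp⟩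

theorem sub_zsmul_root_mem_weightLattice [P.IsRootSystem] [P.IsCrystallographic] {μ : E}
    (hμ : μ ∈ weightLattice b) (k : ℤ) (j : ι) : μ - k • P.root j ∈ weightLattice b := by
  rw [mem_weightLattice_iff] at hμ ⊢
  intro i
  obtain ⟨n, hn⟩ := hμ i
  obtain ⟨c, hc⟩ := exists_coroot_root_eq_int (P := P) i j
  refine ⟨n - k * c, ?_⟩
  rw [map_sub, map_zsmul, hn, hc]
  simp

theorem reflection_eq_sub_zsmul {μ : E} {i : ι} {n : ℤ} (h : P.coroot' i μ = n) :
    P.reflection i μ = μ - n • P.root i := by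
  rw [RootPairing.reflection_apply, h, Int.cast_smul_eq_zsmul]

/-! ### Words in the simple reflections -/

/-- The action of a word in the simple reflections on the weight space. -/
noncomputable def wordAct (l : List b.support) (x : E) : E :=
  l.foldr (fun i y => P.reflection i y) x

/-- The action of a word in the simple reflections on the indices of the roots. -/
noncomputable def wordPerm (l : List b.support) (k : ι) : ι :=
  l.foldr (fun i j => P.reflectionPerm i j) k

theorem wordAct_append (l l' : List b.support) (x : E) :
    wordAct (l ++ l') x = wordAct l (wordAct l' x) := by
  simp [wordAct, List.foldr_append]

theorem root_wordPerm (l : List b.support) (k : ι) :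
    P.root (wordPerm l k) = wordAct l (P.root k) := by
  induction l with
  | nil => rfl
  | cons i l ih =>
    change P.root (P.reflectionPerm i (wordPerm l k)) = P.reflection i (wordAct l (P.root k))
    rw [RootPairing.root_reflectionPerm, ih]

theorem wordAct_sub_zsmul (l : List b.support) (x y : E) (n : ℤ) :
    wordAct l (x - n • y) = wordAct l x - n • wordAct l y := by
  induction l with
  | nil => rfl
  | cons i l ih =>
    change P.reflection i (wordAct l _) =
      P.reflection i (wordAct l x) - n • P.reflection i (wordAct l y)
    rw [ih, map_sub, map_zsmul]

/-- Conjugating a reflection by a word gives the reflection in the transformed root; this lets two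
letters cancel in `exists_shorter_word`. -/
theorem reflection_wordPerm_wordAct (l : List b.support) (k : ι) (x : E) :
    P.reflection (wordPerm l k) (wordAct l x) = wordAct l (P.reflection k x) := by
  induction l with
  | nil => rfl
  | cons i l ih =>
    change P.reflection (P.reflectionPerm i (wordPerm l k)) (P.reflection i (wordAct l x)) =
      P.reflection i (wordAct l (P.reflection k x))
    rw [RootPairing.reflection_reflectionPerm, ← ih]
    simp

/-- The deletion property of words in the simple reflections. -/
theorem exists_shorter_word [Finite ι] [P.IsCrystallographic] [P.IsReduced]
    (l : List b.support) (t : b.support) (h : ¬ b.IsPos (wordPerm l t)) :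
    ∃ l' : List b.support, l'.length < l.length + 1 ∧
      ∀ x : E, wordAct (l ++ [t]) x = wordAct l' x := by
  induction l with
  | nil => exact absurd (RootPairing.Base.isPos_of_mem_support t.2) h
  | cons i l ih =>
    by_cases hp : b.IsPos (wordPerm l t)
    · have hi : wordPerm l t = i := by
        by_contra hne
        exact h (hp.reflectionPerm i.2 hne)
      refine ⟨l, by simp, fun x => ?_⟩
      rw [wordAct_append]
      change P.reflection i (wordAct l (P.reflection t x)) = _
      rw [← hi, reflection_wordPerm_wordAct, RootPairing.reflection_same]
    · obtain ⟨l', hl', hx⟩ := ih hp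
      refine ⟨i :: l', by simpa using hl', fun x => ?_⟩
      change P.reflection i (wordAct (l ++ [t]) x) = P.reflection i (wordAct l' x)
      rw [hx]

/-- Induction on the length of l s_t. If l α_t is positive, then l s_t ν is l ν minus a nonnegative
multiple of it, by dominance of ν; otherwise the word can be shortened. -/
theorem wordAct_weightLE [Finite ι] [P.IsRootSystem] [P.IsCrystallographic] [P.IsReduced]
    {ν : E} (hν : ν ∈ dominantWeights b) (l : List b.support) : WeightLE b (wordAct l ν) ν := by
  induction hn : l.length using Nat.strong_induction_on generalizing l with
  | _ n ih =>
    rcases List.eq_nil_or_concat l with rfl | ⟨l, t, rfl⟩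
    · exact WeightLE.refl b ν
    · rw [List.concat_eq_append] at hn ⊢
      rw [List.length_append, List.length_singleton] at hn
      by_cases hp : b.IsPos (wordPerm l t)
      · refine WeightLE.trans ?_ (ih l.length (by omega) l rfl)
        obtain ⟨m, hm⟩ := mem_dominantWeights_iff.1 hν t
        rw [wordAct_append]
        change WeightLE b (wordAct l (P.reflection t ν)) _
        rw [reflection_eq_sub_zsmul (n := (m : ℤ)) (by simp [hm]), wordAct_sub_zsmul,
          ← root_wordPerm, natCast_zsmul]
        exact weightLE_sub_nsmul_root hp _ m
      · obtain ⟨l', hl', hx⟩ := exists_shorter_word l t hp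
        rw [hx]
        exact ih l'.length (by omega) l' rfl

theorem exists_word_of_reflection [Finite ι] [P.IsCrystallographic] [P.IsReduced] (i : ι) :
    ∃ l : List b.support, ∀ x : E, P.reflection i x = wordAct l x := by
  induction i using b.induction_reflect with
  | h₀ i ih =>
    obtain ⟨l, hl⟩ := ih
    exact ⟨l, fun x => by rw [RootPairing.reflection_reflectionPerm, ← hl]; simp⟩
  | h₁ i hi => exact ⟨[⟨i, hi⟩], fun x => rfl⟩
  | h₂ i j ih hj =>
    obtain ⟨l, hl⟩ := ih
    refine ⟨⟨j, hj⟩ :: (l ++ [⟨j, hj⟩]), fun x => ?_⟩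
    change _ = P.reflection j (wordAct (l ++ [⟨j, hj⟩]) x)
    rw [wordAct_append, RootPairing.reflection_reflectionPerm, ← hl]
    rfl

theorem exists_word_of_mem_weylGroup [Finite ι] [P.IsCrystallographic] [P.IsReduced]
    {w : P.Aut} (hw : w ∈ P.weylGroup) :
    ∃ l : List b.support, ∀ x : E, w • x = wordAct l x := by
  induction hw using RootPairing.weylGroup.induction with
  | mem i => exact exists_word_of_reflection i
  | one => exact ⟨[], fun x => one_smul _ x⟩
  | mul g₁ g₂ _ _ h₁ h₂ =>
    obtain ⟨l₁, h₁⟩ := h₁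
    obtain ⟨l₂, h₂⟩ := h₂
    exact ⟨l₁ ++ l₂, fun x => by rw [mul_smul, h₂, h₁, wordAct_append]⟩

/-! ### Weyl group orbits -/

theorem smul_weightLE [Finite ι] [P.IsRootSystem] [P.IsCrystallographic] [P.IsReduced]
    {ν : E} (hν : ν ∈ dominantWeights b) {w : P.Aut} (hw : w ∈ P.weylGroup) :
    WeightLE b (w • ν) ν := by
  obtain ⟨l, hl⟩ := exists_word_of_mem_weylGroup (b := b) hw
  rw [hl]
  exact wordAct_weightLE hν l

theorem smul_sub_zsmul (w : P.Aut) (x y : E) (n : ℤ) : w • (x - n • y) = w • x - n • w • y := by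
  rw [smul_sub, smul_comm]

theorem reflection_mem_weightLattice [P.IsRootSystem] [P.IsCrystallographic] {μ : E}
    (hμ : μ ∈ weightLattice b) (i : b.support) : P.reflection i μ ∈ weightLattice b := by
  obtain ⟨n, hn⟩ := mem_weightLattice_iff.1 hμ i
  rw [reflection_eq_sub_zsmul hn]
  exact sub_zsmul_root_mem_weightLattice hμ n i

theorem smul_mem_weightLattice [Finite ι] [P.IsRootSystem] [P.IsCrystallographic] [P.IsReduced]
    {μ : E} (hμ : μ ∈ weightLattice b) {w : P.Aut} (hw : w ∈ P.weylGroup) :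
    w • μ ∈ weightLattice b := by
  obtain ⟨l, hl⟩ := exists_word_of_mem_weylGroup (b := b) hw
  rw [hl]
  clear hl
  induction l with
  | nil => exact hμ
  | cons i l ih => exact reflection_mem_weightLattice ih i

/-- In coordinates along the simple roots, the image of μ depends only on how `w` permutes the
finitely many roots. -/
theorem finite_orbit [Finite ι] [P.IsRootSystem] (b : P.Base) (μ : E) :
    (Set.range fun w : P.weylGroup => w • μ).Finite := by
  refine (Set.finite_range fun σ : Equiv.Perm ι =>
    ∑ i : b.support, b.toWeightBasis.repr μ i • P.root (σ i)).subset ?_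
  rintro _ ⟨w, rfl⟩
  refine ⟨P.weylGroupToPerm w, ?_⟩
  have h := b.toWeightBasis.sum_repr μ
  simp only [← RootPairing.weylGroup_apply_root]
  conv_rhs => rw [← h]
  simp only [b.toWeightBasis_apply, Finset.smul_sum]
  exact Finset.sum_congr rfl fun i _ => (smul_comm (w : P.Aut) _ (P.root i)).symm

/-- A point of greatest height in the orbit is dominant: applying s_i lowers the height by the
pairing with the i-th simple coroot, which is thus nonnegative. -/
theorem exists_smul_mem_dominantWeights [Finite ι] [P.IsRootSystem] [P.IsCrystallographic]
    [P.IsReduced] {μ : E} (hμ : μ ∈ weightLattice b) :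
    ∃ w ∈ P.weylGroup, w • μ ∈ dominantWeights b := by
  obtain ⟨_, ⟨⟨w, hw⟩, rfl⟩, hmax⟩ := Set.exists_max_image _ (heightFun b) (finite_orbit b μ)
    ⟨_, ⟨1, rfl⟩⟩
  refine ⟨w, hw, mem_dominantWeights_iff.2 fun i => ?_⟩
  obtain ⟨n, hn⟩ := mem_weightLattice_iff.1 (smul_mem_weightLattice hμ hw) i
  have h := hmax _ ⟨⟨_, mul_mem (P.reflection_mem_weylGroup i) hw⟩, rfl⟩
  change heightFun b ((RootPairing.Equiv.reflection P i * w) • μ) ≤ heightFun b (w • μ) at h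
  rw [mul_smul, RootPairing.Equiv.reflection_smul, reflection_eq_sub_zsmul hn, map_sub, map_zsmul,
    heightFun_root] at h
  have h0 : (0 : ℝ) ≤ n := by simpa using h
  have h0' : 0 ≤ n := by exact_mod_cast h0
  lift n to ℕ using h0'
  exact ⟨n, by simpa using hn⟩

/-! ### Weight diagrams -/

/-- Dominant weights dominate their orbits, so the dominant conjugate controls all conjugates. This
form makes string closure checkable one `w` at a time. -/
theorem mem_weightDiagramSet_iff [Finite ι] [P.IsRootSystem] [P.IsCrystallographic] [P.IsReduced]
    {lam μ : E} : μ ∈ weightDiagramSet b lam ↔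
      μ ∈ weightLattice b ∧ ∀ w ∈ P.weylGroup, WeightLE b (w • μ) lam := by
  constructor
  · rintro ⟨hμ, w, hw, ν, hν, hle, rfl⟩
    refine ⟨hμ, fun w' hw' => ?_⟩
    rw [← mul_smul]
    exact (smul_weightLE hν (mul_mem hw' hw)).trans hle
  · rintro ⟨hμ, h⟩
    obtain ⟨w, hw, hdom⟩ := exists_smul_mem_dominantWeights hμ
    exact ⟨hμ, w⁻¹, inv_mem hw, w • μ, hdom, h w hw, by simp⟩

/-- A set of weights is string-closed if with `μ` it contains the part of the `α_i`-string through
`μ` lying between `μ` and its reflection, for each `i`. -/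
def IsStringClosed (b : P.Base) (S : Set E) : Prop :=
  ∀ μ ∈ S, ∀ i : b.support, ∃ n : ℤ, P.coroot' i μ = n ∧
    ∀ k : ℤ, (0 ≤ k ∧ k ≤ n ∨ n ≤ k ∧ k ≤ 0) → μ - k • P.root i ∈ S

/-- With β = w α_i, the weight w(μ − k α_i) = w μ − k β lies on the β-string between w μ and w s_i μ
= w μ − n β, both below `lam`. It is below whichever end is the higher, as decided by the signs of β
and k. -/
theorem isStringClosed_weightDiagramSet [Finite ι] [P.IsRootSystem] [P.IsCrystallographic]
    [P.IsReduced] (lam : E) : IsStringClosed b (weightDiagramSet b lam) := by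
  intro μ hμ i
  rw [mem_weightDiagramSet_iff] at hμ
  obtain ⟨hμ, hle⟩ := hμ
  obtain ⟨n, hn⟩ := mem_weightLattice_iff.1 hμ i
  refine ⟨n, hn, fun k hk => ?_⟩
  rw [mem_weightDiagramSet_iff]
  refine ⟨sub_zsmul_root_mem_weightLattice hμ k i, fun w hw => ?_⟩
  have hroot : w • P.root i = P.root (P.weylGroupToPerm ⟨w, hw⟩ i) :=
    P.weylGroup_apply_root ⟨w, hw⟩ i
  have hr := hle _ (mul_mem hw (P.reflection_mem_weylGroup i))
  rw [mul_smul, RootPairing.Equiv.reflection_smul, reflection_eq_sub_zsmul hn, smul_sub_zsmul,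
    hroot] at hr
  rw [smul_sub_zsmul, hroot]
  generalize P.weylGroupToPerm ⟨w, hw⟩ i = j at hr
  by_cases h : b.IsPos j ∧ 0 ≤ k ∨ ¬ b.IsPos j ∧ k ≤ 0
  · exact WeightLE.trans (weightLE_of_sub_eq_zsmul_root (by abel) h) (hle w hw)
  · refine WeightLE.trans (weightLE_of_sub_eq_zsmul_root (n := k - n) (k := j) ?_ ?_) hr
    · rw [sub_smul]; abel
    · by_cases hj : b.IsPos j
      · simp only [hj, true_and, not_true, false_and, or_false] at h ⊢
        omega
      · simp only [hj, false_and, not_false_eq_true, true_and, false_or] at h ⊢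
        omega

theorem IsStringClosed.reflection_mem {S : Set E} (hS : IsStringClosed b S) {μ : E} (hμ : μ ∈ S)
    (i : b.support) : P.reflection i μ ∈ S := by
  obtain ⟨n, hn, h⟩ := hS μ hμ i
  rw [reflection_eq_sub_zsmul hn]
  exact h n (by omega)

theorem IsStringClosed.smul_mem [Finite ι] [P.IsCrystallographic] [P.IsReduced] {S : Set E}
    (hS : IsStringClosed b S) {μ : E} (hμ : μ ∈ S) {w : P.Aut} (hw : w ∈ P.weylGroup) :
    w • μ ∈ S := by
  obtain ⟨l, hl⟩ := exists_word_of_mem_weylGroup (b := b) hw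
  rw [hl]
  clear hl
  induction l with
  | nil => exact hμ
  | cons i l ih => exact hS.reflection_mem ih i

/-- A nonzero nonnegative combination of simple roots pairs positively with the coroot of some
simple root occurring in it. -/
theorem exists_coroot_pos [Finite ι] [P.IsRootSystem] [P.IsCrystallographic] (k : b.support → ℕ)
    (hk : ∑ i, k i • P.root i ≠ 0) :
    ∃ i : b.support, 0 < k i ∧ 0 < P.coroot' i (∑ i, k i • P.root i) := by
  have := Fintype.ofFinite ι
  by_contra! h
  set x := ∑ i, k i • P.root i with hx
  have hpos : 0 < P.RootForm x x := by
    refine P.rootForm_pos_of_ne_zero ?_ hk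
    exact Submodule.sum_mem _ fun i _ => nsmul_mem
      (show P.root i ∈ P.rootSpan ℝ from Submodule.subset_span ⟨i, rfl⟩) _
  -- The form of α_i with x is half the squared length of α_i times the pairing of x with the
  -- coroot, so each term with k_i > 0 is nonpositive.
  have hle : P.RootForm x x ≤ 0 := by
    have hsum : P.RootForm x x = ∑ i, P.RootForm (k i • P.root i) x := by
      rw [← LinearMap.sum_apply, ← map_sum]
    rw [hsum]
    refine Finset.sum_nonpos fun i _ => ?_
    rw [map_nsmul, LinearMap.smul_apply, nsmul_eq_mul]
    rcases Nat.eq_zero_or_pos (k i) with h0 | h0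
    · simp [h0]
    · refine mul_nonpos_of_nonneg_of_nonpos (Nat.cast_nonneg _) ?_
      have h1 := congrArg (P.toLinearMap x) (P.rootForm_self_smul_coroot i)
      rw [map_smul, map_nsmul, RootPairing.toLinearMap_apply_apply_Polarization] at h1
      have h2 : 0 ≤ P.RootForm (P.root i) (P.root i) := by
        rw [RootPairing.rootForm_apply_apply]
        exact Finset.sum_nonneg fun j _ => mul_self_nonneg _
      have h3 : P.toLinearMap x (P.coroot i) ≤ 0 := h i h0
      have h4 := mul_nonpos_of_nonneg_of_nonpos h2 h3
      rw [smul_eq_mul, nsmul_eq_mul] at h1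
      rw [h1] at h4
      push_cast at h4
      linarith
  linarith

theorem IsStringClosed.mem_of_dominant [Finite ι] [P.IsRootSystem] [P.IsCrystallographic]
    {S : Set E} (hS : IsStringClosed b S) {lam ν : E} (hlam : lam ∈ S)
    (hν : ν ∈ dominantWeights b) (hle : WeightLE b ν lam) : ν ∈ S := by
  classical
  obtain ⟨k, hk⟩ := hle
  induction hn : ∑ i, k i generalizing k lam with
  | zero =>
    have : lam - ν = 0 := by
      rw [hk]
      refine Finset.sum_eq_zero fun i hi => ?_
      rw [Finset.sum_eq_zero_iff.1 hn i hi, zero_smul]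
    rwa [← sub_eq_zero.1 this]
  | succ n ih =>
    by_cases h0 : lam - ν = 0
    · rwa [← sub_eq_zero.1 h0]
    obtain ⟨i, hi, hpos⟩ := exists_coroot_pos (b := b) k (hk ▸ h0)
    rw [← hk, map_sub] at hpos
    obtain ⟨m, hm⟩ := mem_dominantWeights_iff.1 hν i
    obtain ⟨a, ha, hstr⟩ := hS lam hlam i
    have ha0 : (0 : ℝ) < a := by
      rw [hm, ha] at hpos
      have : (0 : ℝ) ≤ m := Nat.cast_nonneg m
      linarith
    have ha1 : 0 < a := by exact_mod_cast ha0
    have hsum : k = Function.update k i (k i - 1) + Pi.single i 1 := by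
      funext j
      by_cases hj : j = i
      · subst hj; simp; omega
      · simp [hj]
    refine ih (hstr 1 (by omega)) (k := Function.update k i (k i - 1)) ?_ ?_
    · rw [sub_right_comm, hk]
      conv_lhs => rw [hsum]
      simp only [Pi.add_apply, add_smul, Finset.sum_add_distrib]
      rw [Finset.sum_eq_single (f := fun j => ((Pi.single i 1 : b.support → ℕ) j) • P.root j) i
        (by intro j _ hj; simp [hj]) (by simp)]
      simp
    · rw [hsum] at hn
      simp only [Pi.add_apply, Finset.sum_add_distrib, Finset.sum_pi_single'] at hn
      simp at hn
      simpa using hn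

theorem IsStringClosed.weightDiagramSet_subset [Finite ι] [P.IsRootSystem]
    [P.IsCrystallographic] [P.IsReduced] {S : Set E} (hS : IsStringClosed b S) {lam : E}
    (hlam : lam ∈ S) : weightDiagramSet b lam ⊆ S := by
  rintro _ ⟨-, w, hw, ν, hν, hle, rfl⟩
  exact hS.smul_mem (hS.mem_of_dominant hlam hν hle) hw

theorem weightDiagram_adj_iff [P.IsRootSystem] {lam μ ν : E} {i : b.support} :
    (weightDiagram b lam).Adj i μ ν ↔
      μ ∈ weightDiagramSet b lam ∧ ν ∈ weightDiagramSet b lam ∧ μ + P.root i = ν := by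
  constructor
  · rintro ⟨hμ, hν, -, h⟩
    exact ⟨hμ, hν, h⟩
  · rintro ⟨hμ, hν, rfl⟩
    refine ⟨hμ, hν, ⟨fun h => ?_, weightLE_add_root b μ i, fun ξ _ h₁ h₂ =>
      h₁.eq_or_eq_of_between h₂⟩, rfl⟩
    exact not_weightLE_of_add_root (b := b) μ i (h ▸ WeightLE.refl b μ)

end RootSystem

end WeightDiagrams

namespace WeightDiagrams

namespace ColoredRankedPoset

/-! ### Ranks within components -/

variable {R : Type*} [PartialOrder R] {I : Type*} (X : ColoredRankedPoset R I)

theorem comp_eq_of_mem {i : I} {x y : R} (h : y ∈ X.comp i x) : X.comp i y = X.comp i x := by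
  ext z
  exact ⟨fun hz => .trans _ _ _ h hz, fun hz => .trans _ _ _ (.symm _ _ h) hz⟩

/-- On each component, `rho` is the rank function and `len` is constantly its length. -/
theorem isRankFunction_rho (i : I) (x : R) :
    IsRankFunction (fun s t : X.comp i x => X.Edge i s t) (fun y => X.rho i y) (X.len i x) ∧
      ∀ y ∈ X.comp i x, X.len i y = X.len i x := by
  have key : ∀ y : X.comp i x,
      X.rho i y = (X.exists_compRank i x).choose.1 y ∧ X.len i y = X.len i x := by
    intro y
    have h := X.comp_eq_of_mem y.2
    have hs := (X.exists_compRank i x).choose_spec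
    -- The ranks at `y` and at `x` come from separate choices; after transport along the equality of
    -- components, uniqueness identifies them.
    have hs' : IsRankFunction (fun s t : X.comp i (y : R) => X.Edge i s t)
        (fun z => (X.exists_compRank i x).choose.1 ⟨z, h.le z.2⟩) (X.len i x) := by
      refine ⟨?_, fun s t hst => hs.2 ⟨s, h.le s.2⟩ ⟨t, h.le t.2⟩ hst⟩
      rw [len, ← hs.1]
      ext k
      constructor
      · rintro ⟨z, rfl⟩
        exact ⟨_, rfl⟩
      · rintro ⟨z, rfl⟩
        exact ⟨⟨z, h.ge z.2⟩, rfl⟩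
    obtain ⟨h1, h2⟩ := X.compRank_unique i y _ _ _ _ (X.exists_compRank i y).choose_spec hs'
    exact ⟨congrFun h1 ⟨y, X.mem_comp_self i y⟩, h2⟩
  refine ⟨?_, fun y hy => (key ⟨y, hy⟩).2⟩
  have : (fun y : X.comp i x => X.rho i y) = (X.exists_compRank i x).choose.1 :=
    funext fun y => (key y).1
  rw [this]
  exact (X.exists_compRank i x).choose_spec

theorem rho_le_len (i : I) (x : R) : X.rho i x ≤ X.len i x := by
  have h := (X.isRankFunction_rho i x).1.1
  have : X.rho i x ∈ Set.Iic (X.len i x) := h ▸ ⟨⟨x, X.mem_comp_self i x⟩, rfl⟩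
  exact this

theorem exists_mem_comp_rho_eq (i : I) (x : R) {k : ℕ} (hk : k ≤ X.len i x) :
    ∃ y ∈ X.comp i x, X.rho i y = k := by
  have h : k ∈ Set.range fun y : X.comp i x => X.rho i y := by
    rw [(X.isRankFunction_rho i x).1.1]
    exact hk
  obtain ⟨y, hy⟩ := h
  exact ⟨y, y.2, hy⟩

theorem Edge.rho_add_one {i : I} {s t : R} (h : X.Edge i s t) : X.rho i s + 1 = X.rho i t :=
  (X.isRankFunction_rho i s).1.2 ⟨s, X.mem_comp_self i s⟩ ⟨t, .rel _ _ h⟩ h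

/-- A path in a component meets an edge between any two consecutive ranks that it crosses. -/
theorem exists_edge_crossing {i : I} {x y : R} (h : Relation.EqvGen (X.Edge i) x y) (k : ℕ)
    (hk : X.rho i x ≤ k ∧ k + 1 ≤ X.rho i y ∨ X.rho i y ≤ k ∧ k + 1 ≤ X.rho i x) :
    ∃ s t, s ∈ X.comp i x ∧ X.Edge i s t ∧ X.rho i s = k := by
  induction h with
  | rel a b h =>
    have := h.rho_add_one
    exact ⟨a, b, X.mem_comp_self i a, h, by omega⟩
  | refl a => omega
  | symm a b h ih =>
    obtain ⟨s, t, hs, hst⟩ := ih hk.symm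
    exact ⟨s, t, .trans _ _ _ (.symm _ _ h) hs, hst⟩
  | trans a b c hab hbc ih1 ih2 =>
    by_cases h1 : X.rho i a ≤ k ∧ k + 1 ≤ X.rho i b ∨ X.rho i b ≤ k ∧ k + 1 ≤ X.rho i a
    · exact ih1 h1
    · obtain ⟨s, t, hs, hst⟩ := ih2 (by omega)
      exact ⟨s, t, .trans _ _ _ hab hs, hst⟩

theorem exists_edge_of_lt_len (i : I) (x : R) {k : ℕ} (hk : k < X.len i x) :
    ∃ s t, s ∈ X.comp i x ∧ X.Edge i s t ∧ X.rho i s = k := by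
  obtain ⟨y, hy, hyk⟩ := X.exists_mem_comp_rho_eq i x hk.le
  obtain ⟨z, hz, hzk⟩ := X.exists_mem_comp_rho_eq i x (k := k + 1) hk
  obtain ⟨s, t, hs, hst⟩ := X.exists_edge_crossing
    (Relation.EqvGen.trans _ _ _ (.symm _ _ hy) hz) k (by omega)
  exact ⟨s, t, .trans _ _ _ hy hs, hst⟩

theorem nonempty (X : ColoredRankedPoset R I) : Nonempty R := by
  obtain ⟨ρ, l, hρ, -⟩ := X.ranked
  obtain ⟨x, -⟩ : 0 ∈ Set.range ρ := by rw [hρ]; exact Nat.zero_le _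
  exact ⟨x⟩

theorem m_eq (i : I) (x : R) : X.m i x = 2 * X.rho i x - X.len i x := by
  rw [m, delta]
  ring

end ColoredRankedPoset

/-! ### Weights of structured posets, indomitable sets and the main equivalences -/

section Structured

variable {ι E F : Type*} [AddCommGroup E] [Module ℝ E] [AddCommGroup F] [Module ℝ F]
  {P : RootPairing ι ℝ E F} {b : P.Base} [P.IsRootSystem]
  {R : Type*} [PartialOrder R] {X : ColoredRankedPoset R b.support}

theorem coroot_wt (x : R) (i : b.support) : P.coroot' i (wt b X x) = X.m i x :=
  coroot_sum_zsmul_fundWeight _ i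

theorem wt_mem_weightLattice (x : R) : wt b X x ∈ weightLattice b := ⟨_, rfl⟩

/-- Weights within a component are determined by ranks. -/
theorem wt_eq_of_mem_comp (hX : IsStructured b X) {i : b.support} {x y : R}
    (h : y ∈ X.comp i x) :
    wt b X y = wt b X x + ((X.rho i y : ℤ) - X.rho i x) • P.root i := by
  induction (h : Relation.EqvGen (X.Edge i) x y) with
  | rel a c h =>
    rw [← hX i a c h, ← h.rho_add_one]
    simp
  | refl a => simp
  | symm a c h ih =>
    rw [ih, add_assoc, ← add_smul]
    simp
  | trans a c d h h' ih ih' =>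
    rw [ih', ih, add_assoc, ← add_smul]
    congr 2
    ring

/-- Lowering the rank by k for k between 0 and m_i = 2ρ_i − l_i leads to a rank between ρ_i and l_i
− ρ_i, which the component attains. -/
theorem isStringClosed_range_wt (hX : IsStructured b X) :
    IsStringClosed b (Set.range (wt b X)) := by
  rintro _ ⟨x, rfl⟩ i
  refine ⟨X.m i x, coroot_wt x i, fun k hk => ?_⟩
  have h1 := X.rho_le_len i x
  rw [X.m_eq] at hk
  obtain ⟨y, hy, hyk⟩ := X.exists_mem_comp_rho_eq i x (k := ((X.rho i x : ℤ) - k).toNat) (by omega)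
  refine ⟨y, ?_⟩
  rw [wt_eq_of_mem_comp hX hy, show (X.rho i y : ℤ) - X.rho i x = -k by omega, neg_smul,
    sub_eq_add_neg]

/-- The element `x` need not itself have an upward edge of color i, but some element of its
component with the same rank, hence the same weight, does. -/
theorem exists_edge_above (hX : IsStructured b X) {i : b.support} {x : R}
    (h : X.rho i x < X.len i x) :
    ∃ s t, X.Edge i s t ∧ wt b X s = wt b X x ∧ wt b X t = wt b X x + P.root i := by
  obtain ⟨s, t, hs, hst, hk⟩ := X.exists_edge_of_lt_len i x h
  have hw : wt b X s = wt b X x := by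
    rw [wt_eq_of_mem_comp hX hs, hk]
    simp
  exact ⟨s, t, hst, hw, by rw [← hX i s t hst, hw]⟩

theorem exists_edge_below (hX : IsStructured b X) {i : b.support} {x : R}
    (h : 0 < X.rho i x) :
    ∃ s t, X.Edge i s t ∧ wt b X s + P.root i = wt b X x ∧ wt b X t = wt b X x := by
  have h1 := X.rho_le_len i x
  obtain ⟨s, t, hs, hst, hk⟩ := X.exists_edge_of_lt_len i x (k := X.rho i x - 1) (by omega)
  have hw : wt b X s + P.root i = wt b X x := by
    rw [wt_eq_of_mem_comp hX hs, hk, show ((X.rho i x - 1 : ℕ) : ℤ) - X.rho i x = -1 by omega]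
    simp
  exact ⟨s, t, hst, hw, by rw [← hX i s t hst, hw]⟩

theorem genWeightDiagram_adj_iff (hX : IsStructured b X) {μ ν : E} {i : b.support} :
    (genWeightDiagram b X).Adj i μ ν ↔
      μ ∈ Set.range (wt b X) ∧ ν ∈ Set.range (wt b X) ∧ μ + P.root i = ν := by
  constructor
  · rintro ⟨x, y, hxy, rfl, rfl⟩
    exact ⟨⟨x, rfl⟩, ⟨y, rfl⟩, hX i x y hxy⟩
  · rintro ⟨⟨x, rfl⟩, ⟨y, rfl⟩, h⟩
    -- If y had rank 0 and x full rank in their i-components, then m_i(y) ≤ 0 ≤ m_i(x), which is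
    -- impossible; so one of them supplies the edge.
    have hm : X.m i y = X.m i x + 2 := by
      have h2 := coroot_wt (b := b) (X := X) y i
      rw [← h, map_add, coroot_wt, coroot_root_self] at h2
      exact_mod_cast h2.symm
    rw [X.m_eq, X.m_eq] at hm
    by_cases h0 : 0 < X.rho i y
    · obtain ⟨s, t, hst, hs, ht⟩ := exists_edge_below hX h0
      exact ⟨s, t, hst, add_right_cancel (hs.trans h.symm), ht⟩
    · obtain ⟨s, t, hst, hs, ht⟩ := exists_edge_above hX (x := x) (i := i) (by omega)
      exact ⟨s, t, hst, hs, ht.trans h⟩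

/-- An element whose weight is maximal is prominent. -/
theorem isProminent_of_maximal (hX : IsStructured b X) {x : R}
    (h : ∀ y, WeightLE b (wt b X x) (wt b X y) → wt b X x = wt b X y) : X.IsProminent x := by
  intro i
  have h1 := X.rho_le_len i x
  by_contra hd
  rw [ColoredRankedPoset.delta] at hd
  obtain ⟨s, t, -, -, ht⟩ := exists_edge_above hX (x := x) (i := i) (by omega)
  have h2 := h t (ht ▸ weightLE_add_root b _ i)
  rw [ht] at h2
  exact not_weightLE_of_add_root (b := b) (wt b X x) i (by rw [← h2]; exact WeightLE.refl b _)

theorem wt_mem_dominantWeights_of_isProminent {x : R} (h : X.IsProminent x) :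
    wt b X x ∈ dominantWeights b := by
  refine mem_dominantWeights_iff.2 fun i => ⟨X.rho i x, ?_⟩
  rw [coroot_wt, ColoredRankedPoset.m, h i]
  simp

theorem exists_maximal_above [Finite R] (x : R) :
    ∃ y, WeightLE b (wt b X x) (wt b X y) ∧
      ∀ z, WeightLE b (wt b X y) (wt b X z) → wt b X y = wt b X z := by
  obtain ⟨y, hy, hmax⟩ := Set.exists_max_image {y : R | WeightLE b (wt b X x) (wt b X y)}
    (fun y => heightFun b (wt b X y)) (Set.toFinite _) ⟨x, WeightLE.refl b _⟩
  exact ⟨y, hy, fun z hz => hz.eq_of_heightFun_le (hmax z (WeightLE.trans hy hz))⟩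

theorem wt_mem_weightDiagramSet_iff [Finite ι] [P.IsCrystallographic] [P.IsReduced] {x y : R}
    (hx : wt b X x ∈ dominantWeights b) :
    wt b X x ∈ weightDiagramSet b (wt b X y) ↔ WeightLE b (wt b X x) (wt b X y) := by
  constructor
  · intro h
    have := (mem_weightDiagramSet_iff.1 h).2 1 (one_mem _)
    rwa [one_smul] at this
  · intro h
    exact ⟨wt_mem_weightLattice x, 1, one_mem _, _, hx, h, (one_smul _ _).symm⟩

theorem iUnion_weightDiagramSet_subset [Finite ι] [P.IsCrystallographic] [P.IsReduced]
    (hX : IsStructured b X) (N : Set R) :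
    ⋃ n ∈ N, weightDiagramSet b (wt b X n) ⊆ Set.range (wt b X) :=
  Set.iUnion₂_subset fun n _ => (isStringClosed_range_wt hX).weightDiagramSet_subset ⟨n, rfl⟩

theorem range_wt_eq_iff_exists_isMinimallyIndomitable [Finite ι] [P.IsCrystallographic]
    [P.IsReduced] [Finite R] (hX : IsStructured b X) (N : Set R) :
    Set.range (wt b X) = ⋃ n ∈ N, weightDiagramSet b (wt b X n) ↔
      ∃ D : Set R, IsMinimallyIndomitable b X D ∧ D ⊆ N := by
  constructor
  · intro h
    have hrep : ∀ y : R, (∀ z, WeightLE b (wt b X y) (wt b X z) → wt b X y = wt b X z) →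
        ∃ n ∈ N, wt b X n = wt b X y := by
      intro y hy
      have hmem : wt b X y ∈ ⋃ n ∈ N, weightDiagramSet b (wt b X n) := h ▸ ⟨y, rfl⟩
      obtain ⟨n, hn, hyn⟩ := Set.mem_iUnion₂.1 hmem
      rw [wt_mem_weightDiagramSet_iff (wt_mem_dominantWeights_of_isProminent
        (isProminent_of_maximal hX hy))] at hyn
      exact ⟨n, hn, (hy n hyn).symm⟩
    -- The representative must depend on the weight only, so that distinct chosen elements have
    -- distinct weights. Away from maximal weights its value is arbitrary.
    have hrep' : ∀ μ : E, ∃ n : R,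
        (∃ y, wt b X y = μ ∧ ∀ z, WeightLE b (wt b X y) (wt b X z) → wt b X y = wt b X z) →
          n ∈ N ∧ wt b X n = μ := by
      intro μ
      by_cases hμ : ∃ y, wt b X y = μ ∧
          ∀ z, WeightLE b (wt b X y) (wt b X z) → wt b X y = wt b X z
      · obtain ⟨y, rfl, hy⟩ := hμ
        obtain ⟨n, hn⟩ := hrep y hy
        exact ⟨n, fun _ => hn⟩
      · obtain ⟨x⟩ := X.nonempty
        exact ⟨x, fun h => absurd h hμ⟩
    choose f hf using hrep'
    let Y : Set R := {y | ∀ z, WeightLE b (wt b X y) (wt b X z) → wt b X y = wt b X z}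
    have hfY : ∀ y ∈ Y, f (wt b X y) ∈ N ∧ wt b X (f (wt b X y)) = wt b X y :=
      fun y hy => hf _ ⟨y, rfl, hy⟩
    have hprom : ∀ d ∈ (fun y => f (wt b X y)) '' Y, X.IsProminent d := by
      rintro _ ⟨y, hy, rfl⟩
      refine isProminent_of_maximal hX ?_
      rw [(hfY y hy).2]
      exact hy
    obtain ⟨x₀⟩ := X.nonempty
    refine ⟨(fun y => f (wt b X y)) '' Y, ⟨⟨?_, hprom, ?_⟩, ?_⟩, ?_⟩
    · obtain ⟨y, -, hy⟩ := exists_maximal_above (X := X) x₀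
      exact ⟨_, y, hy, rfl⟩
    · intro x _
      obtain ⟨y, hxy, hy⟩ := exists_maximal_above (X := X) x
      refine ⟨_, ⟨y, hy, rfl⟩, ?_⟩
      dsimp only
      rwa [(hfY y hy).2]
    -- A chosen element lies below some member of `D'`; maximality makes their weights equal, hence
    -- also the elements.
    · rintro D' ⟨hD', hne⟩ ⟨-, -, hind⟩
      refine hne ?_
      rintro _ ⟨y, hy, rfl⟩
      obtain ⟨d, hd, hle⟩ := hind _ (hprom _ ⟨y, hy, rfl⟩)
      obtain ⟨z, hz, rfl⟩ := hD' hd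
      dsimp only at hle hd ⊢
      rw [(hfY y hy).2, (hfY z hz).2] at hle
      rwa [hy z hle]
    · rintro _ ⟨y, hy, rfl⟩
      exact (hfY y hy).1
  · rintro ⟨D, ⟨⟨-, -, hD⟩, -⟩, hDN⟩
    refine Set.Subset.antisymm ?_ (iUnion_weightDiagramSet_subset hX N)
    rintro _ ⟨x, rfl⟩
    obtain ⟨w, hw, hdom⟩ := exists_smul_mem_dominantWeights (wt_mem_weightLattice (X := X) x)
    obtain ⟨z, hz⟩ := (isStringClosed_range_wt hX).smul_mem ⟨x, rfl⟩ hw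
    obtain ⟨y, hzy, hy⟩ := exists_maximal_above (X := X) z
    obtain ⟨d, hd, hyd⟩ := hD y (isProminent_of_maximal hX hy)
    refine Set.mem_iUnion₂.2 ⟨d, hDN hd, wt_mem_weightLattice x, w⁻¹, inv_mem hw, _, hdom, ?_,
      by simp⟩
    rw [← hz]
    exact hzy.trans hyd

/-- Two weights differing by a simple root and lying in a union of weight diagrams lie in a common
one of them. -/
theorem exists_common_weightDiagramSet [Finite ι] [P.IsCrystallographic] [P.IsReduced]
    {K : Type*} {lam : K → E} {k k' : K} {μ : E} {i : b.support}
    (h : μ ∈ weightDiagramSet b (lam k)) (h' : μ + P.root i ∈ weightDiagramSet b (lam k')) :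
    ∃ j, μ ∈ weightDiagramSet b (lam j) ∧ μ + P.root i ∈ weightDiagramSet b (lam j) := by
  obtain ⟨n, hn, hstr⟩ := isStringClosed_weightDiagramSet _ μ h i
  obtain ⟨n', hn', hstr'⟩ := isStringClosed_weightDiagramSet _ _ h' i
  have hnn : n' = n + 2 := by
    rw [map_add, hn, coroot_root_self] at hn'
    exact_mod_cast hn'.symm
  -- If n < 0, the string from μ goes up, so one step reaches μ + α_i. Otherwise n' ≥ 2 and one step
  -- down from μ + α_i reaches μ.
  by_cases h0 : n < 0
  · refine ⟨k, h, ?_⟩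
    simpa using hstr (-1) (by omega)
  · refine ⟨k', ?_, h'⟩
    simpa using hstr' 1 (by omega)

theorem genWeightDiagram_eq_iff_verts_eq [Finite ι] [P.IsCrystallographic] [P.IsReduced]
    (hX : IsStructured b X) (N : Set R) :
    genWeightDiagram b X = ColoredDigraph.iUnion (fun n : N => weightDiagram b (wt b X n)) ↔
      (genWeightDiagram b X).verts = ⋃ n ∈ N, (weightDiagram b (wt b X n)).verts := by
  rw [Set.biUnion_eq_iUnion]
  constructor
  · intro h
    rw [h]
    rfl
  · intro h
    refine ColoredDigraph.ext h ?_
    have hmem : ∀ μ, μ ∈ Set.range (wt b X) ↔ ∃ n : N, μ ∈ weightDiagramSet b (wt b X n) :=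
      fun μ => by
        have := Set.ext_iff.1 h μ
        rwa [Set.mem_iUnion] at this
    funext i μ ν
    refine propext ?_
    rw [genWeightDiagram_adj_iff hX, hmem, hmem]
    change _ ↔ ∃ n : N, (weightDiagram b (wt b X n)).Adj i μ ν
    simp only [weightDiagram_adj_iff]
    constructor
    · rintro ⟨⟨k, hk⟩, ⟨k', hk'⟩, rfl⟩
      obtain ⟨j, hj, hj'⟩ := exists_common_weightDiagramSet
        (lam := fun n : N => wt b X n) hk hk'
      exact ⟨j, hj, hj', rfl⟩
    · rintro ⟨n, hμ, hν, h⟩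
      exact ⟨⟨n, hμ⟩, ⟨n, hν⟩, h⟩

end Structured

end WeightDiagrams

theorem theorem3p8 {ι E F : Type*} [Finite ι] [AddCommGroup E] [Module ℝ E] [AddCommGroup F]
    [Module ℝ F] (P : RootPairing ι ℝ E F) [P.IsRootSystem] [P.IsCrystallographic] [P.IsReduced]
    (b : P.Base) {R : Type*} [PartialOrder R] [Finite R]
    (X : WeightDiagrams.ColoredRankedPoset R b.support) (hX : WeightDiagrams.IsStructured b X)
    (N : Set R) (hN : ∀ n ∈ N, WeightDiagrams.wt b X n ∈ WeightDiagrams.dominantWeights b) :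
    (WeightDiagrams.genWeightDiagram b X =
          WeightDiagrams.ColoredDigraph.iUnion
            (fun n : N => WeightDiagrams.weightDiagram b (WeightDiagrams.wt b X n)) ↔
        (WeightDiagrams.genWeightDiagram b X).verts =
          ⋃ n ∈ N, (WeightDiagrams.weightDiagram b (WeightDiagrams.wt b X n)).verts) ∧
      ((WeightDiagrams.genWeightDiagram b X).verts =
          ⋃ n ∈ N, (WeightDiagrams.weightDiagram b (WeightDiagrams.wt b X n)).verts ↔
        ∃ D : Set R, WeightDiagrams.IsMinimallyIndomitable b X D ∧ D ⊆ N) := by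
  exact ⟨WeightDiagrams.genWeightDiagram_eq_iff_verts_eq hX N,
    WeightDiagrams.range_wt_eq_iff_exists_isMinimallyIndomitable hX N⟩
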